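/- Let $d\ge 0$ be an integer. For $r>0$ let $\mathcal B_r^d$ be the set of Borel sets $B\subset\{x\in\mathbb R^d:|x|\ge r\}$, and let $\mathcal B_0^d=\bigcup_{r>0}\mathcal B_r^d$. A function $\nu:\mathcal B_0^d\to\mathbb R$ is a *quasi-Lévy type measure* if $\nu_{|\mathcal B_r^d}$ is a finite signed measure for every $r>0$ and $\int_{\mathbb R^d}(1\wedge|x|^2)\,\nu^{\pm}(dx)<\infty$, where $\nu^+$ and $\nu^-$ are the unique Borel measures on $\mathbb R^d$ with $\nu^{\pm}(\{0\})=0$ that agree on each $\mathcal B_r^d$ with the positive and negative part of $\nu_{|\mathcal B_r^d}$; one puts $\int f\,d\nu=\int f\,d\nu^+-\int f\,d\nu^-$. A function $\nu:\mathcal B_0^d\to\mathbb C$ is a *complex quasi-Lévy type measure* if $\Re\nu$ and $\Im\nu$ are quasi-Lévy type measures; one puts $\int f\,d\nu=\int f\,d(\Re\nu)+\mathrm i\int f\,d(\Im\nu)$. A probability distribution $\mu$ on $\mathbb R^d$ is *quasi-infinitely divisible* if there are infinitely divisible distributions $\mu_1,\mu_2$ on $\mathbb R^d$ with $\widehat\mu(z)=\widehat\mu_1(z)/\widehat\mu_2(z)$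 for all $z\in\mathbb R^d$, where $\widehat\mu(z)=\int_{\mathbb R^d}e^{\mathrm i\langle z,x\rangle}\,\mu(dx)$. **Theorem.** Let $\mu$ be a probability distribution on $\mathbb R^d$ whose characteristic function admits the representation $$\widehat\mu(z)=\exp\left(\mathrm i\langle\gamma,z\rangle-\tfrac12\langle z,Az\rangle+\int_{\mathbb R^d}\left(e^{\mathrm i\langle z,x\rangle}-1-\mathrm i\langle z,x\rangle\mathbf 1_{[0,1]}(|x|)\right)\nu(dx)\right)\qquad\text{for every } z\in\mathbb R^d,$$ with a symmetric matrix $A\in\mathbb C^{d\times d}$, a complex quasi-Lévy type measure $\nu$ on $\mathbb R^d$ and $\gamma\in\mathbb C^d$, where $\langle\gamma,z\rangle=\sum_i\gamma_iz_i$ and $\langle z,Az\rangle=\sum_{i,j}z_iA_{ij}z_j$. Then $A\in\mathbb R^{d\times d}$, $\gamma\in\mathbb R^d$ and $\Im\nu=0$; that is, $\nu$ is a quasi-Lévy type measure, and $\mu$ is quasi-infinitely divisible. -/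

import Mathlib

open MeasureTheory

noncomputable section

/-- Borel subsets of `ℝ^d` contained in `{x : r ≤ |x|}`. -/
def borelAway (d : ℕ) (r : ℝ) : Set (Set (EuclideanSpace ℝ (Fin d))) :=
  {B | MeasurableSet B ∧ B ⊆ {x | r ≤ ‖x‖}}

/-- Borel subsets of `ℝ^d` bounded away from `0`. -/
def borelOffZero (d : ℕ) : Set (Set (EuclideanSpace ℝ (Fin d))) :=
  ⋃ r ∈ Set.Ioi (0 : ℝ), borelAway d r

theorem borelAway_subset {d : ℕ} {r : ℝ} (hr : 0 < r) : borelAway d r ⊆ borelOffZero d :=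
  Set.subset_biUnion_of_mem (u := fun r => borelAway d r) (Set.mem_Ioi.2 hr)

theorem iUnion_mem_borelAway {d : ℕ} {r : ℝ} {f : ℕ → Set (EuclideanSpace ℝ (Fin d))}
    (hf : ∀ i, f i ∈ borelAway d r) : (⋃ i, f i) ∈ borelAway d r :=
  ⟨MeasurableSet.iUnion fun i => (hf i).1, Set.iUnion_subset fun i => (hf i).2⟩

theorem empty_mem_borelAway (d : ℕ) (r : ℝ) : ∅ ∈ borelAway d r :=
  ⟨MeasurableSet.empty, Set.empty_subset _⟩

theorem measurableSet_away (d : ℕ) (r : ℝ) :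
    MeasurableSet {x : EuclideanSpace ℝ (Fin d) | r ≤ ‖x‖} :=
  measurableSet_le measurable_const measurable_norm

theorem inter_mem_borelAway {d : ℕ} {r : ℝ} {B : Set (EuclideanSpace ℝ (Fin d))}
    (hB : MeasurableSet B) : B ∩ {x | r ≤ ‖x‖} ∈ borelAway d r :=
  ⟨hB.inter (measurableSet_away d r), Set.inter_subset_right⟩

/-- A set function `ν` on the Borel sets bounded away from `0` whose restriction to the Borel
subsets of `{x : r ≤ |x|}` is a finite signed measure, for every `r > 0`. -/
structure IsSignedOffZero {d : ℕ} (ν : borelOffZero d → ℝ) : Prop where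
  empty : ∀ r : ℝ, ∀ hr : 0 < r, ν ⟨∅, borelAway_subset hr (empty_mem_borelAway d r)⟩ = 0
  iUnion : ∀ r : ℝ, ∀ hr : 0 < r, ∀ f : ℕ → Set (EuclideanSpace ℝ (Fin d)),
    ∀ hf : (∀ i, f i ∈ borelAway d r), Pairwise (Function.onFun Disjoint f) →
      HasSum (fun i => ν ⟨f i, borelAway_subset hr (hf i)⟩)
        (ν ⟨⋃ i, f i, borelAway_subset hr (iUnion_mem_borelAway hf)⟩)

namespace IsSignedOffZero

variable {d : ℕ} {ν : borelOffZero d → ℝ}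

open Classical in
/-- The restriction of `ν` to the Borel subsets of `{x : r ≤ |x|}`, as a finite signed measure
on `ℝ^d` that does not charge `{x : |x| < r}`. -/
def restrict (h : IsSignedOffZero ν) (r : ℝ) (hr : 0 < r) :
    SignedMeasure (EuclideanSpace ℝ (Fin d)) where
  measureOf' B := if hB : MeasurableSet B then
    ν ⟨B ∩ {x | r ≤ ‖x‖}, borelAway_subset hr (inter_mem_borelAway hB)⟩ else 0
  empty' := by
    simpa using h.empty r hr
  not_measurable' B hB := by simp [hB]
  m_iUnion' f hf hd := by
    have := h.iUnion r hr (fun i => f i ∩ {x | r ≤ ‖x‖}) (fun i => inter_mem_borelAway (hf i))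
      (fun i j hij => (hd hij).mono Set.inter_subset_left Set.inter_subset_left)
    simpa [hf, MeasurableSet.iUnion hf, Set.iUnion_inter] using this

theorem restrict_apply (h : IsSignedOffZero ν) {r : ℝ} (hr : 0 < r)
    {B : Set (EuclideanSpace ℝ (Fin d))} (hB : B ∈ borelAway d r) :
    h.restrict r hr B = ν ⟨B, borelAway_subset hr hB⟩ := by
  have hB' : B ∩ {x | r ≤ ‖x‖} = B := Set.inter_eq_left.2 hB.2
  change (@dite ℝ (MeasurableSet B) (Classical.propDecidable _) _ _) = _
  simp [hB.1, hB']

end IsSignedOffZero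

/-- The shells `{1 ≤ |x|}` and `{1 / (n + 1) ≤ |x| < 1 / n}`, `n ≥ 1`, which partition
`ℝ^d \ {0}`. -/
def shell (d : ℕ) (n : ℕ) : Set (EuclideanSpace ℝ (Fin d)) :=
  disjointed (fun k : ℕ => {x | 1 / ((k : ℝ) + 1) ≤ ‖x‖}) n

namespace IsSignedOffZero

variable {d : ℕ} {ν : borelOffZero d → ℝ}

/-- The positive part `ν⁺`: the Borel measure on `ℝ^d` with `ν⁺({0}) = 0` that agrees on the
Borel subsets of each `{x : r ≤ |x|}` with the positive part of the restriction of `ν`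
(see `posPart_spec` and `posPart_unique`). It is obtained by glueing over the shells. -/
def posPart (h : IsSignedOffZero ν) : Measure (EuclideanSpace ℝ (Fin d)) :=
  Measure.sum fun n : ℕ =>
    (h.restrict (1 / ((n : ℝ) + 1)) Nat.one_div_pos_of_nat).toJordanDecomposition.posPart.restrict
      (shell d n)

/-- The negative part `ν⁻` (see `negPart_spec` and `negPart_unique`). -/
def negPart (h : IsSignedOffZero ν) : Measure (EuclideanSpace ℝ (Fin d)) :=
  Measure.sum fun n : ℕ =>
    (h.restrict (1 / ((n : ℝ) + 1)) Nat.one_div_pos_of_nat).toJordanDecomposition.negPart.restrict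
      (shell d n)

/-- `f` is integrable with respect to `ν`, i.e. with respect to `ν⁺` and `ν⁻`. -/
def Integrable (h : IsSignedOffZero ν) (f : EuclideanSpace ℝ (Fin d) → ℂ) : Prop :=
  MeasureTheory.Integrable f h.posPart ∧ MeasureTheory.Integrable f h.negPart

/-- `∫ f dν = ∫ f dν⁺ - ∫ f dν⁻`. -/
def integral (h : IsSignedOffZero ν) (f : EuclideanSpace ℝ (Fin d) → ℂ) : ℂ :=
  (∫ x, f x ∂h.posPart) - ∫ x, f x ∂h.negPart

end IsSignedOffZero

/-! The next facts check that `posPart` and `negPart` are what they should be. -/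

theorem shell_measurable (d n : ℕ) : MeasurableSet (shell d n) :=
  MeasurableSet.disjointed (fun _ => measurableSet_away d _) n

theorem shell_subset (d n : ℕ) : shell d n ⊆ {x | 1 / ((n : ℝ) + 1) ≤ ‖x‖} :=
  disjointed_subset _ n

theorem shell_disjoint (d : ℕ) : Pairwise (Function.onFun Disjoint (shell d)) :=
  disjoint_disjointed _

theorem iUnion_shell (d : ℕ) : (⋃ n, shell d n) = {0}ᶜ := by
  unfold shell
  rw [iUnion_disjointed]
  ext x
  simp only [Set.mem_iUnion, Set.mem_ofPred_eq, Set.mem_compl_iff, Set.mem_singleton_iff]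
  constructor
  · rintro ⟨n, hn⟩ rfl
    have : (0 : ℝ) < 1 / ((n : ℝ) + 1) := Nat.one_div_pos_of_nat
    rw [norm_zero] at hn
    linarith
  · intro hx
    obtain ⟨n, hn⟩ := exists_nat_one_div_lt (norm_pos_iff.2 hx)
    exact ⟨n, hn.le⟩

theorem jordan_restrict {α : Type*} [MeasurableSpace α] (s : SignedMeasure α) {S : Set α}
    (hS : MeasurableSet S) :
    (SignedMeasure.toJordanDecomposition (VectorMeasure.restrict s S)).posPart
        = s.toJordanDecomposition.posPart.restrict S ∧
      (SignedMeasure.toJordanDecomposition (VectorMeasure.restrict s S)).negPart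
        = s.toJordanDecomposition.negPart.restrict S := by
  let j : JordanDecomposition α :=
    { posPart := s.toJordanDecomposition.posPart.restrict S
      negPart := s.toJordanDecomposition.negPart.restrict S
      posPart_finite := inferInstance
      negPart_finite := inferInstance
      mutuallySingular := (s.toJordanDecomposition.mutuallySingular.mono
        Measure.restrict_le_self Measure.restrict_le_self) }
  have hj : VectorMeasure.restrict s S = j.toSignedMeasure := by
    ext B hB
    rw [VectorMeasure.restrict_apply _ hS hB, s.apply_eq_posPart_real_sub_negPart_real (hB.inter hS)]
    simp [j, JordanDecomposition.toSignedMeasure, 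
      Measure.toSignedMeasure_apply_measurable hB, measureReal_restrict_apply hB]
  rw [SignedMeasure.toJordanDecomposition_eq hj]
  exact ⟨rfl, rfl⟩

/-- Glueing over the shells a consistent family of measures on the sets `{x : r ≤ |x|}`. -/
theorem glue_spec {d : ℕ} (m : ∀ r : ℝ, 0 < r → Measure (EuclideanSpace ℝ (Fin d)))
    (hm : ∀ r s : ℝ, ∀ hr : 0 < r, ∀ hs : 0 < s, r ≤ s →
      m s hs = (m r hr).restrict {x | s ≤ ‖x‖}) :
    (Measure.sum fun n : ℕ => (m (1 / ((n : ℝ) + 1)) Nat.one_div_pos_of_nat).restrict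
      (shell d n)) {0} = 0 ∧
    ∀ r : ℝ, ∀ hr : 0 < r, ∀ B ∈ borelAway d r,
      (Measure.sum fun n : ℕ => (m (1 / ((n : ℝ) + 1)) Nat.one_div_pos_of_nat).restrict
        (shell d n)) B = m r hr B := by
  have key : ∀ r s : ℝ, ∀ hr : 0 < r, ∀ hs : 0 < s, ∀ C, MeasurableSet C →
      C ⊆ {x | r ≤ ‖x‖} → C ⊆ {x | s ≤ ‖x‖} → m r hr C = m s hs C := by
    intro r s hr hs C hC h1 h2
    rcases le_total r s with h | h
    · rw [hm r s hr hs h, Measure.restrict_apply hC, Set.inter_eq_left.2 h2]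
    · rw [hm s r hs hr h, Measure.restrict_apply hC, Set.inter_eq_left.2 h1]
  constructor
  · rw [Measure.sum_apply _ (measurableSet_singleton 0), ENNReal.tsum_eq_zero]
    intro n
    rw [Measure.restrict_apply (measurableSet_singleton 0)]
    have : ({0} : Set (EuclideanSpace ℝ (Fin d))) ∩ shell d n = ∅ := by
      rw [Set.singleton_inter_eq_empty]
      intro h0
      have h1 : (0 : EuclideanSpace ℝ (Fin d)) ∈ ⋃ n, shell d n := Set.mem_iUnion.2 ⟨n, h0⟩
      rw [iUnion_shell] at h1
      exact h1 rfl
    rw [this, measure_empty]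
  · intro r hr B hB
    rw [Measure.sum_apply _ hB.1]
    have h1 : B = ⋃ n, B ∩ shell d n := by
      rw [← Set.inter_iUnion, iUnion_shell, eq_comm, Set.inter_eq_left]
      intro x hx h0
      have h2 : r ≤ ‖x‖ := hB.2 hx
      rw [Set.mem_singleton_iff.1 h0, norm_zero] at h2
      linarith
    conv_rhs => rw [h1]
    rw [measure_iUnion
      (fun i j hij => (shell_disjoint d hij).mono Set.inter_subset_right Set.inter_subset_right)
      (fun n => hB.1.inter (shell_measurable d n))]
    refine tsum_congr fun n => ?_
    rw [Measure.restrict_apply hB.1]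
    exact key _ _ _ _ _ (hB.1.inter (shell_measurable d n))
      (Set.inter_subset_right.trans (shell_subset d n)) (Set.inter_subset_left.trans hB.2)

theorem measure_unique_offZero {d : ℕ} {m m' : Measure (EuclideanSpace ℝ (Fin d))}
    (h0 : m {0} = 0) (h0' : m' {0} = 0)
    (h : ∀ r : ℝ, 0 < r → ∀ B ∈ borelAway d r, m B = m' B) : m = m' := by
  have aux : ∀ p : Measure (EuclideanSpace ℝ (Fin d)), p {0} = 0 → ∀ B, MeasurableSet B →
      p B = ∑' n, p (B ∩ shell d n) := by
    intro p hp B hB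
    rw [← measure_iUnion
      (fun i j hij => (shell_disjoint d hij).mono Set.inter_subset_right Set.inter_subset_right)
      (fun n => hB.inter (shell_measurable d n)), ← Set.inter_iUnion, iUnion_shell,
      ← Set.sdiff_eq, measure_sdiff_null hp]
  ext B hB
  rw [aux m h0 B hB, aux m' h0' B hB]
  exact tsum_congr fun n => h _ Nat.one_div_pos_of_nat _
    ⟨hB.inter (shell_measurable d n), Set.inter_subset_right.trans (shell_subset d n)⟩

namespace IsSignedOffZero

variable {d : ℕ} {ν : borelOffZero d → ℝ}

theorem restrict_restrict (h : IsSignedOffZero ν) {r s : ℝ} (hr : 0 < r) (hs : 0 < s)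
    (hrs : r ≤ s) :
    h.restrict s hs = VectorMeasure.restrict (h.restrict r hr) {x | s ≤ ‖x‖} := by
  ext B hB
  rw [VectorMeasure.restrict_apply _ (measurableSet_away d s) hB]
  have hsub : {x : EuclideanSpace ℝ (Fin d) | s ≤ ‖x‖} ⊆ {x | r ≤ ‖x‖} :=
    fun x hx => hrs.trans hx
  rw [h.restrict_apply hr ⟨hB.inter (measurableSet_away d s),
    Set.inter_subset_right.trans hsub⟩]
  change (@dite ℝ (MeasurableSet B) (Classical.propDecidable _) _ _) = _
  simp [hB]

theorem posPart_spec (h : IsSignedOffZero ν) :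
    h.posPart {0} = 0 ∧ ∀ r : ℝ, ∀ hr : 0 < r, ∀ B ∈ borelAway d r,
      h.posPart B = (h.restrict r hr).toJordanDecomposition.posPart B :=
  glue_spec (fun r hr => (h.restrict r hr).toJordanDecomposition.posPart)
    fun r s hr hs hrs => by
      rw [h.restrict_restrict hr hs hrs]
      exact (jordan_restrict _ (measurableSet_away d s)).1

theorem negPart_spec (h : IsSignedOffZero ν) :
    h.negPart {0} = 0 ∧ ∀ r : ℝ, ∀ hr : 0 < r, ∀ B ∈ borelAway d r,
      h.negPart B = (h.restrict r hr).toJordanDecomposition.negPart B :=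
  glue_spec (fun r hr => (h.restrict r hr).toJordanDecomposition.negPart)
    fun r s hr hs hrs => by
      rw [h.restrict_restrict hr hs hrs]
      exact (jordan_restrict _ (measurableSet_away d s)).2

theorem posPart_unique (h : IsSignedOffZero ν) {m : Measure (EuclideanSpace ℝ (Fin d))}
    (h0 : m {0} = 0) (hm : ∀ r : ℝ, ∀ hr : 0 < r, ∀ B ∈ borelAway d r,
      m B = (h.restrict r hr).toJordanDecomposition.posPart B) : m = h.posPart :=
  measure_unique_offZero h0 h.posPart_spec.1 fun r hr B hB => by
    rw [hm r hr B hB, h.posPart_spec.2 r hr B hB]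

theorem negPart_unique (h : IsSignedOffZero ν) {m : Measure (EuclideanSpace ℝ (Fin d))}
    (h0 : m {0} = 0) (hm : ∀ r : ℝ, ∀ hr : 0 < r, ∀ B ∈ borelAway d r,
      m B = (h.restrict r hr).toJordanDecomposition.negPart B) : m = h.negPart :=
  measure_unique_offZero h0 h.negPart_spec.1 fun r hr B hB => by
    rw [hm r hr B hB, h.negPart_spec.2 r hr B hB]

end IsSignedOffZero

/-- Quasi-Lévy type measures on `ℝ^d`. -/
structure IsQuasiLevyType {d : ℕ} (ν : borelOffZero d → ℝ) : Prop where
  signed : IsSignedOffZero ν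
  integrable : signed.Integrable fun x => ((min 1 (‖x‖ ^ 2) : ℝ) : ℂ)

/-- Complex quasi-Lévy type measures on `ℝ^d`. -/
structure IsComplexQuasiLevyType {d : ℕ} (ν : borelOffZero d → ℂ) : Prop where
  re : IsQuasiLevyType fun B => (ν B).re
  im : IsQuasiLevyType fun B => (ν B).im

/-- `∫ f dν = ∫ f d(Re ν) + i ∫ f d(Im ν)`. -/
def IsComplexQuasiLevyType.integral {d : ℕ} {ν : borelOffZero d → ℂ}
    (h : IsComplexQuasiLevyType ν) (f : EuclideanSpace ℝ (Fin d) → ℂ) : ℂ :=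
  h.re.signed.integral f + Complex.I * h.im.signed.integral f

open Classical in
/-- `e^{i⟨z,x⟩} - 1 - i⟨z,x⟩ 1_{[0,1]}(|x|)`. -/
def levyKernel {d : ℕ} (z x : EuclideanSpace ℝ (Fin d)) : ℂ :=
  Complex.exp (Complex.I * (inner ℝ z x : ℝ)) - 1
    - Complex.I * (inner ℝ z x : ℝ) * (if ‖x‖ ≤ 1 then 1 else 0)

/-- The `n`-fold convolution of a measure on `ℝ^d` with itself. -/
def convPower {d : ℕ} (μ : Measure (EuclideanSpace ℝ (Fin d))) :
    ℕ → Measure (EuclideanSpace ℝ (Fin d))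
  | 0 => Measure.dirac 0
  | n + 1 => Measure.conv (convPower μ n) μ

/-- Infinitely divisible distributions on `ℝ^d`. -/
def IsInfinitelyDivisible {d : ℕ} (μ : Measure (EuclideanSpace ℝ (Fin d))) : Prop :=
  IsProbabilityMeasure μ ∧ ∀ n : ℕ, 1 ≤ n →
    ∃ ρ : Measure (EuclideanSpace ℝ (Fin d)), IsProbabilityMeasure ρ ∧ convPower ρ n = μ

/-- Quasi-infinitely divisible distributions on `ℝ^d`. (The characteristic function of an
infinitely divisible distribution has no zeros.) -/
def IsQuasiInfinitelyDivisible {d : ℕ} (μ : Measure (EuclideanSpace ℝ (Fin d))) : Prop :=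
  IsProbabilityMeasure μ ∧ ∃ μ₁ μ₂ : Measure (EuclideanSpace ℝ (Fin d)),
    IsInfinitelyDivisible μ₁ ∧ IsInfinitelyDivisible μ₂ ∧
      ∀ z, charFun μ z = charFun μ₁ z / charFun μ₂ z

end

noncomputable section

open Filter Topology

/-! Separate real and imaginary parts of the triplet: the exponent becomes `R + iH`, where `R` and
`H` are Lévy-Khintchine exponents of real triplets, with signed Lévy measures. A real triplet makes
both Hermitian, so the Hermitian symmetry of the characteristic function gives `exp (R + iH) = exp
(R - iH)`, that is `exp (2iH) = 1`. Since `H` is continuous, vanishes at `0` and lives on a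
connected space, `H = 0`.

It remains to see that `H` determines its triplet (`levyKhintchine_unique`). A second difference in
direction `w` kills the drift, turns the quadratic form into a constant `q(w)`, and turns the Lévy
integral into the Fourier transform of the finite signed measure with density `2(1 - cos⟨w,x⟩)`.
Uniqueness of Fourier transforms applies, and the Gaussian part is recognised as an atom at `0`,
which the Lévy part does not charge.

Finally `μ` has exponent `R`. The integrals against the positive and negative parts of the Lévy
measure, the drift and, after polarization, the quadratic form are each differences of infinitely
divisible exponents, and so is `R`. -/

theorem norm_exp_I_mul_sub_one_sub_le (t : ℝ) :
    ‖Complex.exp (Complex.I * t) - 1 - Complex.I * t‖ ≤ 2 * t ^ 2 := by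
  have hI : ‖Complex.I * (t : ℂ)‖ = |t| := by simp
  rcases le_or_gt |t| 1 with h | h
  · refine (Complex.norm_exp_sub_one_sub_id_le (by rwa [hI])).trans ?_
    rw [hI, sq_abs]
    nlinarith [sq_nonneg t]
  -- Here `|t| > 1`, so the crude bound `|t| + |t|` is already at most `2t²`.
  · refine (norm_sub_le _ _).trans ?_
    have := Real.norm_exp_I_mul_ofReal_sub_one_le (x := t)
    rw [hI]
    rw [Real.norm_eq_abs] at this
    rw [← sq_abs t]
    nlinarith

/-! ### Pointwise properties of the Lévy kernel -/

section levyKernel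

variable {d : ℕ} (z w x : EuclideanSpace ℝ (Fin d))

/-- The compensator gives order `|x|²` on the unit ball; outside it the trivial bound `2` is enough.
The explicit dependence on `z` makes the bound locally uniform, as dominated convergence requires.
-/
theorem norm_levyKernel_le : ‖levyKernel z x‖ ≤ 2 * (1 + ‖z‖ ^ 2) * min 1 (‖x‖ ^ 2) := by
  unfold levyKernel
  split_ifs with h
  · rw [mul_one, min_eq_right (pow_le_one₀ (norm_nonneg _) h)]
    refine (norm_exp_I_mul_sub_one_sub_le _).trans ?_
    have h1 : (inner ℝ z x : ℝ) ^ 2 ≤ (‖z‖ * ‖x‖) ^ 2 := by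
      rw [← sq_abs (inner ℝ z x : ℝ)]
      gcongr
      exact abs_real_inner_le_norm z x
    nlinarith [sq_nonneg ‖x‖]
  · rw [mul_zero, sub_zero, min_eq_left (one_le_pow₀ (not_le.1 h).le)]
    refine (norm_sub_le _ _).trans ?_
    rw [Complex.norm_exp_I_mul_ofReal, norm_one]
    nlinarith [sq_nonneg ‖z‖]

theorem measurable_levyKernel : Measurable (levyKernel z) := by
  unfold levyKernel
  refine Measurable.sub (by fun_prop) (Measurable.mul (by fun_prop) ?_)
  exact Measurable.ite (measurableSet_le measurable_norm measurable_const)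
    measurable_const measurable_const

theorem continuous_levyKernel : Continuous fun z => levyKernel z x := by
  unfold levyKernel
  fun_prop

theorem levyKernel_zero : levyKernel 0 x = 0 := by
  simp [levyKernel]

theorem levyKernel_neg : levyKernel (-z) x = (starRingEnd ℂ) (levyKernel z x) := by
  unfold levyKernel
  split_ifs <;> simp [← Complex.exp_conj]

/-- The compensator is linear in `z` and cancels. What is left is a character times a factor
independent of `z`, hence a Fourier transform once integrated. -/
theorem levyKernel_second_difference :
    levyKernel (z + w) x + levyKernel (z - w) x - 2 * levyKernel z x =
      Complex.exp (Complex.I * (inner ℝ z x : ℝ)) * ((2 * (Real.cos (inner ℝ w x) - 1) : ℝ) : ℂ) := by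
  unfold levyKernel
  have h1 : Complex.exp (Complex.I * (inner ℝ (z + w) x : ℝ)) =
      Complex.exp (Complex.I * (inner ℝ z x : ℝ)) * Complex.exp ((inner ℝ w x : ℝ) * Complex.I) := by
    rw [← Complex.exp_add, inner_add_left]; push_cast; ring_nf
  have h2 : Complex.exp (Complex.I * (inner ℝ (z - w) x : ℝ)) =
      Complex.exp (Complex.I * (inner ℝ z x : ℝ)) *
        Complex.exp (-(inner ℝ w x : ℝ) * Complex.I) := by
    rw [← Complex.exp_add, inner_sub_left]; push_cast; ring_nf
  rw [h1, h2, inner_add_left, inner_sub_left]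
  push_cast
  rw [show (2 : ℂ) * (Complex.cos (inner ℝ w x : ℝ) - 1) =
    2 * Complex.cos (inner ℝ w x : ℝ) - 2 by ring, Complex.two_cos]
  ring

end levyKernel

/-! ### Integrals of the kernel against a Lévy measure -/

section LevyMeasure

variable {d : ℕ} {p : Measure (EuclideanSpace ℝ (Fin d))}

theorem integrable_levyKernel (hp : Integrable (fun x => min 1 (‖x‖ ^ 2)) p)
    (z : EuclideanSpace ℝ (Fin d)) : Integrable (levyKernel z) p :=
  (hp.const_mul (2 * (1 + ‖z‖ ^ 2))).mono' (measurable_levyKernel z).aestronglyMeasurable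
    (.of_forall fun x => norm_levyKernel_le z x)

theorem continuous_integral_levyKernel (hp : Integrable (fun x => min 1 (‖x‖ ^ 2)) p) :
    Continuous fun z => ∫ x, levyKernel z x ∂p := by
  refine continuous_iff_continuousAt.2 fun z₀ => ?_
  refine continuousAt_of_dominated (bound := fun x => 2 * (1 + (‖z₀‖ + 1) ^ 2) * min 1 (‖x‖ ^ 2))
    (.of_forall fun z => (measurable_levyKernel z).aestronglyMeasurable) ?_ (hp.const_mul _)
    (.of_forall fun x => (continuous_levyKernel x).continuousAt)
  filter_upwards [Metric.ball_mem_nhds z₀ one_pos] with z hz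
  refine .of_forall fun x => (norm_levyKernel_le z x).trans ?_
  have : ‖z‖ ≤ ‖z₀‖ + 1 := by
    have h1 : ‖z - z₀‖ < 1 := by rwa [← dist_eq_norm]
    have h2 := norm_sub_norm_le z z₀
    linarith
  have h0 : 0 ≤ min 1 (‖x‖ ^ 2) := le_min zero_le_one (sq_nonneg _)
  gcongr

theorem integral_levyKernel_zero : ∫ x, levyKernel 0 x ∂p = 0 := by
  simp [levyKernel_zero]

theorem integral_levyKernel_neg (z : EuclideanSpace ℝ (Fin d)) :
    ∫ x, levyKernel (-z) x ∂p = (starRingEnd ℂ) (∫ x, levyKernel z x ∂p) := by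
  simp_rw [levyKernel_neg]
  exact integral_conj

end LevyMeasure

/-! ### Exponents of infinitely divisible distributions -/

/-- A form of **Lévy's continuity theorem**: a pointwise limit of characteristic functions which is
continuous at `0` is a characteristic function. -/
theorem exists_charFun_eq_of_tendsto {d : ℕ} (μ : ℕ → Measure (EuclideanSpace ℝ (Fin d)))
    [∀ i, IsProbabilityMeasure (μ i)] {f : EuclideanSpace ℝ (Fin d) → ℂ} (hf : ContinuousAt f 0)
    (h : ∀ t, Tendsto (fun n => charFun (μ n) t) atTop (𝓝 (f t))) :
    ∃ ρ : Measure (EuclideanSpace ℝ (Fin d)), IsProbabilityMeasure ρ ∧ ∀ t, charFun ρ t = f t := by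
  let m : ℕ → ProbabilityMeasure (EuclideanSpace ℝ (Fin d)) := fun n => ⟨μ n, inferInstance⟩
  have ht : IsTightMeasureSet (Set.range μ) := isTightMeasureSet_of_tendsto_charFun hf h
  have hc : IsCompact (closure (Set.range m)) := by
    refine isCompact_closure_of_isTightMeasureSet (ht.subset ?_)
    rintro _ ⟨_, ⟨n, rfl⟩, rfl⟩
    exact ⟨n, rfl⟩
  -- Tightness gives relative compactness; an ultrafilter finer than `atTop` then converges to some
  -- `ρ`, with no subsequence to extract.
  let U : Ultrafilter ℕ := Ultrafilter.of atTop
  have hU : (U : Filter ℕ) ≤ atTop := Ultrafilter.of_le _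
  obtain ⟨ρ, -, hρ⟩ := hc.ultrafilter_le_nhds (U.map m)
    (.trans (by simp) (principal_mono.2 subset_closure))
  refine ⟨ρ, inferInstance, fun t => ?_⟩
  have h1 : Tendsto m U (𝓝 ρ) := hρ
  rw [ProbabilityMeasure.tendsto_iff_forall_integral_rclike_tendsto ℂ] at h1
  have h2 := h1 (BoundedContinuousFunction.innerProbChar t)
  simp_rw [← charFun_eq_integral_innerProbChar] at h2
  exact tendsto_nhds_unique h2 ((h t).mono_left hU)

theorem convPower_charFun {d : ℕ} (μ : Measure (EuclideanSpace ℝ (Fin d)))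
    [IsProbabilityMeasure μ] (n : ℕ) :
    IsProbabilityMeasure (convPower μ n) ∧ ∀ z, charFun (convPower μ n) z = charFun μ z ^ n := by
  induction n with
  | zero =>
    refine ⟨by unfold convPower; infer_instance, fun z => ?_⟩
    simp [convPower, charFun_dirac]
  | succ n ih =>
    have := ih.1
    refine ⟨by unfold convPower; infer_instance, fun z => ?_⟩
    rw [convPower, charFun_conv, ih.2, pow_succ]

/-- Functions `Ψ` such that `exp (Ψ / n)` is the characteristic function of a probability
distribution for every `n ≥ 1`. -/
def IsDivisibleExponent {d : ℕ} (Ψ : EuclideanSpace ℝ (Fin d) → ℂ) : Prop :=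
  ∀ n : ℕ, 1 ≤ n → ∃ ρ : Measure (EuclideanSpace ℝ (Fin d)), IsProbabilityMeasure ρ ∧
    ∀ z, charFun ρ z = Complex.exp (Ψ z / n)

namespace IsDivisibleExponent

variable {d : ℕ} {Ψ Ψ₁ Ψ₂ : EuclideanSpace ℝ (Fin d) → ℂ}

theorem exists_isInfinitelyDivisible (h : IsDivisibleExponent Ψ) :
    ∃ μ : Measure (EuclideanSpace ℝ (Fin d)), IsInfinitelyDivisible μ ∧
      ∀ z, charFun μ z = Complex.exp (Ψ z) := by
  obtain ⟨μ, hμ, hμΨ⟩ := h 1 le_rfl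
  refine ⟨μ, ⟨hμ, fun n hn => ?_⟩, by simpa using hμΨ⟩
  obtain ⟨ρ, hρ, hρΨ⟩ := h n hn
  have := (convPower_charFun ρ n).1
  refine ⟨ρ, hρ, Measure.ext_of_charFun (funext fun z => ?_)⟩
  rw [(convPower_charFun ρ n).2, hρΨ, hμΨ, ← Complex.exp_nat_mul, Nat.cast_one, div_one,
    mul_div_cancel₀ _ (Nat.cast_ne_zero.2 (Nat.one_le_iff_ne_zero.1 hn))]

theorem add (h₁ : IsDivisibleExponent Ψ₁) (h₂ : IsDivisibleExponent Ψ₂) :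
    IsDivisibleExponent fun z => Ψ₁ z + Ψ₂ z := by
  intro n hn
  obtain ⟨ρ₁, _, hρ₁⟩ := h₁ n hn
  obtain ⟨ρ₂, _, hρ₂⟩ := h₂ n hn
  refine ⟨ρ₁.conv ρ₂, inferInstance, fun z => ?_⟩
  rw [charFun_conv, hρ₁, hρ₂, ← Complex.exp_add, add_div]

theorem of_tendsto {F : ℕ → EuclideanSpace ℝ (Fin d) → ℂ} (hF : ∀ k, IsDivisibleExponent (F k))
    (hc : ContinuousAt Ψ 0) (h : ∀ z, Tendsto (fun k => F k z) atTop (𝓝 (Ψ z))) :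
    IsDivisibleExponent Ψ := by
  intro n hn
  choose ρ hρ hρF using fun k => hF k n hn
  refine exists_charFun_eq_of_tendsto ρ (hc.div_const _).cexp fun t => ?_
  simp_rw [hρF]
  exact ((h t).div_const _).cexp

theorem inner_left (v : EuclideanSpace ℝ (Fin d)) :
    IsDivisibleExponent fun z => Complex.I * (inner ℝ v z : ℝ) := by
  intro n hn
  refine ⟨Measure.dirac ((n : ℝ)⁻¹ • v), inferInstance, fun z => ?_⟩
  rw [charFun_dirac, real_inner_smul_left]
  push_cast
  ring_nf

theorem gaussian {c : ℝ} (hc : 0 ≤ c) (v : EuclideanSpace ℝ (Fin d)) :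
    IsDivisibleExponent fun z => -(c / 2) * ((inner ℝ v z : ℝ) : ℂ) ^ 2 := by
  intro n hn
  have hm : Measurable fun t : ℝ => t • v := by fun_prop
  refine ⟨(ProbabilityTheory.gaussianReal 0 (c / n).toNNReal).map fun t => t • v,
    Measure.isProbabilityMeasure_map hm.aemeasurable, fun z => ?_⟩
  rw [charFun_apply, integral_map hm.aemeasurable (by fun_prop)]
  have h := ProbabilityTheory.charFun_gaussianReal (μ := 0) (v := (c / n).toNNReal) (inner ℝ v z)
  rw [charFun_apply_real] at h
  simp_rw [real_inner_smul_left]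
  have h0 : (0 : ℝ) ≤ c / n := by positivity
  have h1 : (((c / n).toNNReal : ℝ) : ℂ) = c / n := by
    rw [Real.coe_toNNReal _ h0]; push_cast; rfl
  rw [h1] at h
  push_cast at h ⊢
  simp_rw [mul_comm (Complex.ofReal _) (((inner ℝ v z : ℝ) : ℂ))]
  rw [h]
  congr 1
  ring

/-- This is the compound Poisson exponent. Put `l = m(ℝ^d)` and `N = k + K`. The law `(1 - εl)δ₀ +
εm` with `ε = 1/(nN)`, convolved `N` times, has characteristic function `(1 + (charFun m -
l)/(nN))^N`, and this tends to `exp ((charFun m - l)/n)`. -/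
theorem integral_charFun_sub_one (m : Measure (EuclideanSpace ℝ (Fin d))) [IsFiniteMeasure m] :
    IsDivisibleExponent fun z => charFun m z - m.real Set.univ := by
  intro n hn
  have hn0 : (n : ℂ) ≠ 0 := Nat.cast_ne_zero.2 (Nat.one_le_iff_ne_zero.1 hn)
  have hn1 : (1 : ℝ) ≤ n := by exact_mod_cast hn
  -- Shifting the index by `K ≥ l + 1` makes `1 - εl` nonnegative and the denominator positive for
  -- every `k`, including `k = 0`.
  obtain ⟨K, hK⟩ := exists_nat_ge (m.real Set.univ + 1)
  have hl : 0 ≤ m.real Set.univ := measureReal_nonneg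
  set l := m.real Set.univ with hl_def
  let ε : ℕ → ℝ := fun k => 1 / ((n : ℝ) * ((k + K : ℕ) : ℝ))
  have hKk : ∀ k : ℕ, l + 1 ≤ ((k + K : ℕ) : ℝ) := fun k => by
    push_cast; have : (0 : ℝ) ≤ k := k.cast_nonneg; linarith
  have hε : ∀ k, 0 ≤ ε k := fun k => by positivity
  have hεl : ∀ k, ε k * l ≤ 1 := fun k => by
    have := hKk k
    simp only [ε]
    rw [one_div_mul_eq_div, div_le_one (by nlinarith)]
    nlinarith
  let q : ℕ → Measure (EuclideanSpace ℝ (Fin d)) := fun k =>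
    (ENNReal.ofReal (1 - ε k * l)) • Measure.dirac 0 + (ENNReal.ofReal (ε k)) • m
  have hq : ∀ k, IsProbabilityMeasure (q k) := fun k => ⟨by
    simp only [q, Measure.add_apply, Measure.smul_apply, smul_eq_mul, measure_univ, mul_one]
    rw [← ofReal_measureReal (μ := m) (s := Set.univ), ← ENNReal.ofReal_mul (hε k),
      ← ENNReal.ofReal_add (by linarith [hεl k]) (mul_nonneg (hε k) hl)]
    simp⟩
  have hint : ∀ (μ : Measure (EuclideanSpace ℝ (Fin d))) [IsFiniteMeasure μ] z,
      Integrable (fun x => Complex.exp ((inner ℝ x z : ℝ) * Complex.I)) μ := fun μ _ z =>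
    (integrable_const (1 : ℝ)).mono (by fun_prop) (by simp)
  have hqc : ∀ k z, charFun (q k) z = 1 + ε k * (charFun m z - l) := fun k z => by
    simp only [q]
    rw [charFun_apply, integral_add_measure ((hint _ z).smul_measure (by simp))
      ((hint _ z).smul_measure (by simp)), integral_smul_measure, integral_smul_measure,
      ← charFun_apply, ← charFun_apply, charFun_dirac,
      ENNReal.toReal_ofReal (by linarith [hεl k]), ENNReal.toReal_ofReal (hε k)]
    simp
    ring
  have hcp := fun k => convPower_charFun (q k) (k + K)
  have := fun k => (hcp k).1
  refine exists_charFun_eq_of_tendsto (fun k => convPower (q k) (k + K)) ?_ fun z => ?_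
  · have : Continuous (charFun m) := continuous_charFun
    fun_prop
  · simp_rw [(hcp _).2, hqc]
    have h := (Complex.tendsto_one_add_div_pow_exp ((charFun m z - l) / n)).comp
      (tendsto_add_atTop_nat K)
    refine h.congr fun k => ?_
    simp only [Function.comp, ε]
    congr 2
    push_cast
    rw [div_div, one_div_mul_eq_div]

end IsDivisibleExponent

/-- Away from the origin `p` is finite, so the compensator can be integrated separately: the
truncated integral is a compound Poisson exponent plus a drift. The truncation is then removed by a
limit, continuity of the full integral in `z` being what Lévy's theorem needs. -/
theorem IsDivisibleExponent.integral_levyKernel {d : ℕ} {p : Measure (EuclideanSpace ℝ (Fin d))}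
    (hp : Integrable (fun x => min 1 (‖x‖ ^ 2)) p) :
    IsDivisibleExponent fun z => ∫ x, levyKernel z x ∂p := by
  classical
  let S : ℕ → Set (EuclideanSpace ℝ (Fin d)) := fun k => {x | 1 / ((k : ℝ) + 1) ≤ ‖x‖}
  have hSm : ∀ k, MeasurableSet (S k) := fun k => measurableSet_away d _
  have hSU : (⋃ k, S k) = {0}ᶜ := by
    rw [← iUnion_shell]
    exact (iUnion_disjointed (f := S)).symm
  refine IsDivisibleExponent.of_tendsto
    (F := fun k z => ∫ x in S k, levyKernel z x ∂p) (fun k => ?_)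
    (continuous_integral_levyKernel hp).continuousAt fun z => ?_
  · have hfin : IsFiniteMeasure (p.restrict (S k)) := by
      refine isFiniteMeasure_restrict.2 (ne_of_lt ?_)
      have hε₀ : 0 < 1 / ((k : ℝ) + 1) := Nat.one_div_pos_of_nat
      -- Markov's inequality at level `1/(k+1)²`, which `min 1 (‖x‖ ^ 2)` reaches on all of `S k`
      -- because `1/(k+1) ≤ 1`.
      have hlt := hp.measure_ge_lt_top (pow_pos hε₀ 2)
      refine lt_of_le_of_lt (measure_mono ?_) hlt
      intro x (hx : 1 / ((k : ℝ) + 1) ≤ ‖x‖)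
      refine le_min (pow_le_one₀ hε₀.le ?_) (pow_le_pow_left₀ hε₀.le hx 2)
      rw [div_le_one (by positivity)]
      linarith [(k.cast_nonneg : (0 : ℝ) ≤ k)]
    set m := p.restrict (S k)
    let h : EuclideanSpace ℝ (Fin d) → EuclideanSpace ℝ (Fin d) := fun x => if ‖x‖ ≤ 1 then x else 0
    have hmeas : Measurable h :=
      Measurable.ite (measurableSet_le measurable_norm measurable_const) measurable_id
        measurable_const
    have hint : Integrable h m := by
      refine (integrable_const (1 : ℝ)).mono' hmeas.aestronglyMeasurable (.of_forall fun x => ?_)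
      simp only [h]
      split_ifs with hx
      · exact hx
      · simp
    have hexp : ∀ z, Integrable (fun x => Complex.exp ((inner ℝ x z : ℝ) * Complex.I)) m :=
      fun z => (integrable_const (1 : ℝ)).mono (by fun_prop) (by simp)
    have hk : ∀ z x, levyKernel z x = Complex.exp ((inner ℝ x z : ℝ) * Complex.I) - 1
        - Complex.I * (inner ℝ z (h x) : ℝ) := fun z x => by
      unfold levyKernel
      rw [real_inner_comm, mul_comm Complex.I]
      simp only [h]
      split_ifs <;> simp [real_inner_comm, mul_comm]
    have heq : (fun z => ∫ x, levyKernel z x ∂m) = fun z => (charFun m z - m.real Set.univ)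
        + Complex.I * (inner ℝ (-∫ x, h x ∂m) z : ℝ) := by
      funext z
      simp_rw [hk]
      have hi : Integrable (fun x => Complex.I * ((inner ℝ z (h x) : ℝ) : ℂ)) m :=
        (hint.const_inner z).ofReal.const_mul _
      have he : Integrable (fun x => Complex.exp ((inner ℝ x z : ℝ) * Complex.I) - 1) m :=
        (hexp z).sub (integrable_const _)
      rw [integral_sub he hi, integral_sub (hexp z) (integrable_const _), integral_const_mul, integral_complex_ofReal,
        integral_inner hint, ← charFun_apply, inner_neg_left, real_inner_comm z]
      simp
      ring
    rw [heq]
    exact (IsDivisibleExponent.integral_charFun_sub_one m).add (IsDivisibleExponent.inner_left _)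
  · have hi := integrable_levyKernel hp z
    have hmono : Monotone S := fun i j hij x (hx : 1 / ((i : ℝ) + 1) ≤ ‖x‖) =>
      (Nat.one_div_le_one_div hij).trans hx
    have h := tendsto_setIntegral_of_monotone hSm hmono hi.integrableOn (f := levyKernel z) (μ := p)
    -- The sets `S k` miss only the origin, where the kernel vanishes; a possible atom of `p` there
    -- is harmless.
    rw [hSU, setIntegral_eq_integral_of_forall_compl_eq_zero] at h
    · exact h
    · intro x hx
      have : x = 0 := by simpa using hx
      simp [this, levyKernel]

/-! ### Differences of infinitely divisible exponents -/

/-- Differences of exponents of infinitely divisible distributions. -/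
def IsQuasiDivisibleExponent {d : ℕ} (Ψ : EuclideanSpace ℝ (Fin d) → ℂ) : Prop :=
  ∃ Ψ₁ Ψ₂, IsDivisibleExponent Ψ₁ ∧ IsDivisibleExponent Ψ₂ ∧ ∀ z, Ψ z = Ψ₁ z - Ψ₂ z

theorem IsDivisibleExponent.zero {d : ℕ} :
    IsDivisibleExponent fun _ : EuclideanSpace ℝ (Fin d) => 0 := by
  simpa using IsDivisibleExponent.inner_left (0 : EuclideanSpace ℝ (Fin d))

theorem IsDivisibleExponent.isQuasiDivisibleExponent {d : ℕ} {Ψ : EuclideanSpace ℝ (Fin d) → ℂ}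
    (h : IsDivisibleExponent Ψ) : IsQuasiDivisibleExponent Ψ :=
  ⟨Ψ, _, h, .zero, fun _ => (sub_zero _).symm⟩

namespace IsQuasiDivisibleExponent

variable {d : ℕ} {Ψ Ψ' : EuclideanSpace ℝ (Fin d) → ℂ}

theorem add (h : IsQuasiDivisibleExponent Ψ) (h' : IsQuasiDivisibleExponent Ψ') :
    IsQuasiDivisibleExponent fun z => Ψ z + Ψ' z := by
  obtain ⟨a, b, ha, hb, e⟩ := h
  obtain ⟨a', b', ha', hb', e'⟩ := h'
  exact ⟨_, _, ha.add ha', hb.add hb', fun z => by simp only [e, e']; ring⟩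

theorem neg (h : IsQuasiDivisibleExponent Ψ) : IsQuasiDivisibleExponent fun z => -Ψ z := by
  obtain ⟨a, b, ha, hb, e⟩ := h
  exact ⟨_, _, hb, ha, fun z => by simp only [e]; ring⟩

theorem sum {ι : Type*} (s : Finset ι) {F : ι → EuclideanSpace ℝ (Fin d) → ℂ}
    (h : ∀ i, IsQuasiDivisibleExponent (F i)) :
    IsQuasiDivisibleExponent fun z => ∑ i ∈ s, F i z := by
  classical
  induction s using Finset.induction_on with
  | empty => simpa using IsDivisibleExponent.zero.isQuasiDivisibleExponent
  | insert i s hi ih =>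
    simp_rw [Finset.sum_insert hi]
    exact (h i).add ih

/-- The sign of `c` decides whether the Gaussian factor belongs to the numerator or to the
denominator. -/
theorem square (c : ℝ) (v : EuclideanSpace ℝ (Fin d)) :
    IsQuasiDivisibleExponent fun z => (c : ℂ) * ((inner ℝ v z : ℝ) : ℂ) ^ 2 := by
  rcases le_total 0 c with hc | hc
  · have := (IsDivisibleExponent.gaussian (mul_nonneg zero_le_two hc) v).isQuasiDivisibleExponent.neg
    convert! this using 2
    push_cast
    ring
  · have := (IsDivisibleExponent.gaussian
      (mul_nonneg zero_le_two (neg_nonneg.2 hc)) v).isQuasiDivisibleExponent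
    convert! this using 2
    push_cast
    ring

/-- Polarization: `ab = ((a + b)² - a² - b²)/2`. No positivity of the Gaussian matrix is therefore
needed. -/
theorem mul_inner_mul_inner (c : ℝ) (v w : EuclideanSpace ℝ (Fin d)) :
    IsQuasiDivisibleExponent fun z => (inner ℝ v z : ℝ) * (c : ℂ) * (inner ℝ w z : ℝ) := by
  have := ((square (c / 2) (v + w)).add (square (-c / 2) v)).add (square (-c / 2) w)
  convert! this using 2
  rw [inner_add_left]
  push_cast
  ring

theorem isQuasiInfinitelyDivisible (h : IsQuasiDivisibleExponent Ψ)
    {μ : Measure (EuclideanSpace ℝ (Fin d))} [IsProbabilityMeasure μ]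
    (hμ : ∀ z, charFun μ z = Complex.exp (Ψ z)) : IsQuasiInfinitelyDivisible μ := by
  obtain ⟨a, b, ha, hb, e⟩ := h
  obtain ⟨μ₁, h₁, e₁⟩ := ha.exists_isInfinitelyDivisible
  obtain ⟨μ₂, h₂, e₂⟩ := hb.exists_isInfinitelyDivisible
  exact ⟨inferInstance, μ₁, μ₂, h₁, h₂, fun z => by rw [hμ, e₁, e₂, e, Complex.exp_sub]⟩

end IsQuasiDivisibleExponent

/-! ### Uniqueness of the Lévy-Khintchine triplet -/

section Uniqueness

variable {d : ℕ}

theorem integrable_cos_sub_one {p : Measure (EuclideanSpace ℝ (Fin d))}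
    (hp : Integrable (fun x => min 1 (‖x‖ ^ 2)) p) (w : EuclideanSpace ℝ (Fin d)) :
    Integrable (fun x => 2 * (1 - Real.cos (inner ℝ w x))) p := by
  have h := ((integrable_levyKernel hp (0 + w)).add (integrable_levyKernel hp (0 - w))).sub
    ((integrable_levyKernel hp 0).const_mul 2)
  refine h.re.neg.congr (.of_forall fun x => ?_)
  have := levyKernel_second_difference 0 w x
  simp only [Pi.neg_apply, Pi.sub_apply, Pi.add_apply, this]
  rw [inner_zero_left, Complex.ofReal_zero, mul_zero, Complex.exp_zero, one_mul]
  simp [-Complex.ofReal_cos]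
  ring

theorem charFun_withDensity {p : Measure (EuclideanSpace ℝ (Fin d))}
    {f : EuclideanSpace ℝ (Fin d) → ℝ} (hf : Measurable f) (hf0 : ∀ x, 0 ≤ f x)
    (z : EuclideanSpace ℝ (Fin d)) :
    charFun (p.withDensity fun x => ENNReal.ofReal (f x)) z =
      ∫ x, Complex.exp (Complex.I * (inner ℝ z x : ℝ)) * (f x : ℂ) ∂p := by
  rw [charFun_apply, integral_withDensity_eq_integral_toReal_smul hf.ennreal_ofReal
    (.of_forall fun _ => ENNReal.ofReal_lt_top)]
  refine integral_congr_ae (.of_forall fun x => ?_)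
  simp only [ENNReal.toReal_ofReal (hf0 x), Complex.real_smul]
  rw [real_inner_comm, mul_comm, mul_comm Complex.I]

/-- `1 - cos⟨w, x⟩` for `w = e_i` and `w = √2 e_i` vanish simultaneously only at `x = 0`. -/
theorem exists_cos_inner_ne_one {x : EuclideanSpace ℝ (Fin d)} (hx : x ≠ 0) :
    ∃ j : Fin d × Bool, Real.cos (inner ℝ
      (EuclideanSpace.single j.1 (if j.2 then √2 else 1 : ℝ)) x) ≠ 1 := by
  by_contra! h
  refine hx (PiLp.ext fun i => ?_)
  obtain ⟨a, ha⟩ := (Real.cos_eq_one_iff _).1 (h (i, false))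
  obtain ⟨b, hb⟩ := (Real.cos_eq_one_iff _).1 (h (i, true))
  simp only [EuclideanSpace.inner_single_left] at ha hb
  simp at ha hb
  -- The coordinate is `2πa` and `√2` times it is `2πb`; irrationality of `√2` then forces `a = 0`.
  have hab : (b : ℝ) = √2 * a := by
    have hpi : (2 * Real.pi) ≠ 0 := by positivity
    have : (b : ℝ) * (2 * Real.pi) = √2 * a * (2 * Real.pi) := by
      rw [hb, mul_assoc, ha]
    exact mul_right_cancel₀ hpi this
  by_cases ha0 : a = 0
  · simp [← ha, ha0]
  · exfalso
    exact (irrational_sqrt_two.mul_intCast ha0) ⟨b, by push_cast; exact hab⟩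

/-- A single density `1 - cos⟨w,x⟩` also vanishes away from the origin, but a finite sum over
suitable `w` is positive off `0`. It is finite too, so one can divide by it, and neither measure
charges the remaining point. -/
theorem eq_of_forall_withDensity_cos_eq {p n : Measure (EuclideanSpace ℝ (Fin d))}
    (hp0 : p {0} = 0) (hn0 : n {0} = 0)
    (h : ∀ w : EuclideanSpace ℝ (Fin d),
      p.withDensity (fun x => ENNReal.ofReal (2 * (1 - Real.cos (inner ℝ w x)))) =
        n.withDensity fun x => ENNReal.ofReal (2 * (1 - Real.cos (inner ℝ w x)))) :
    p = n := by
  let f : Fin d × Bool → EuclideanSpace ℝ (Fin d) → ENNReal := fun j x =>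
    ENNReal.ofReal (2 * (1 - Real.cos (inner ℝ
      (EuclideanSpace.single j.1 (if j.2 then √2 else 1 : ℝ)) x)))
  have hfm : ∀ j, Measurable (f j) := fun j => by fun_prop
  have hgm : Measurable (∑' j, f j) := by
    have : (∑' j, f j) = fun x => ∑ j, f j x := by
      rw [tsum_fintype]
      exact funext fun x => Finset.sum_apply x _ _
    rw [this]
    exact Finset.measurable_sum _ fun j _ => hfm j
  have hg : p.withDensity (∑' j, f j) = n.withDensity (∑' j, f j) := by
    rw [withDensity_tsum hfm, withDensity_tsum hfm]
    congr 1
    funext j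
    exact h _
  have hpos : ∀ x ≠ 0, (∑' j, f j) x ≠ 0 := fun x hx => by
    obtain ⟨j, hj⟩ := exists_cos_inner_ne_one hx
    rw [tsum_fintype, Finset.sum_apply]
    intro h0
    have h1 := ENNReal.ofReal_eq_zero.1 (Finset.sum_eq_zero_iff.1 h0 j (Finset.mem_univ _))
    have h2 := lt_of_le_of_ne (Real.cos_le_one _) hj
    linarith
  have htop : ∀ x, (∑' j, f j) x ≠ ⊤ := fun x => by
    rw [tsum_fintype, Finset.sum_apply]
    exact ENNReal.sum_ne_top.2 fun j _ => ENNReal.ofReal_ne_top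
  have key : ∀ m : Measure (EuclideanSpace ℝ (Fin d)), m {0} = 0 →
      (m.withDensity (∑' j, f j)).withDensity (∑' j, f j)⁻¹ = m := fun m hm => by
    refine withDensity_inv_same hgm ?_ (.of_forall htop)
    filter_upwards [compl_mem_ae_iff.2 hm] with x hx using hpos x hx
  rw [← key p hp0, ← key n hn0, hg]

/-- For fixed `w` the hypothesis equates the Fourier transforms of `q(w)δ₀ + f p` and `f n`, where
`f(x) = 2(1 - cos⟨w,x⟩)`. Comparing masses at `0` gives `q(w) = 0`; varying `w` then recovers the
measures. -/
theorem eq_of_charFun_withDensity_cos {p n : Measure (EuclideanSpace ℝ (Fin d))}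
    (hp : Integrable (fun x => min 1 (‖x‖ ^ 2)) p) (hn : Integrable (fun x => min 1 (‖x‖ ^ 2)) n)
    (hp0 : p {0} = 0) (hn0 : n {0} = 0) {q : EuclideanSpace ℝ (Fin d) → ℝ}
    (h : ∀ w z, (q w : ℂ) +
        ∫ x, Complex.exp (Complex.I * (inner ℝ z x : ℝ)) *
          ((2 * (1 - Real.cos (inner ℝ w x)) : ℝ) : ℂ) ∂p =
        ∫ x, Complex.exp (Complex.I * (inner ℝ z x : ℝ)) *
          ((2 * (1 - Real.cos (inner ℝ w x)) : ℝ) : ℂ) ∂n) :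
    (∀ w, q w = 0) ∧ p = n := by
  have main : ∀ w, q w = 0 ∧
      p.withDensity (fun x => ENNReal.ofReal (2 * (1 - Real.cos (inner ℝ w x)))) =
        n.withDensity fun x => ENNReal.ofReal (2 * (1 - Real.cos (inner ℝ w x))) := by
    intro w
    let f : EuclideanSpace ℝ (Fin d) → ℝ := fun x => 2 * (1 - Real.cos (inner ℝ w x))
    have hf : Measurable f := by fun_prop
    have hf0 : ∀ x, 0 ≤ f x := fun x => by
      have := Real.cos_le_one (inner ℝ w x)
      simp only [f]
      linarith
    let P := p.withDensity fun x => ENNReal.ofReal (f x)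
    let N := n.withDensity fun x => ENNReal.ofReal (f x)
    have hPf : IsFiniteMeasure P :=
      isFiniteMeasure_withDensity_ofReal (integrable_cos_sub_one hp w).2
    have hNf : IsFiniteMeasure N :=
      isFiniteMeasure_withDensity_ofReal (integrable_cos_sub_one hn w).2
    have hint : ∀ (μ : Measure (EuclideanSpace ℝ (Fin d))) [IsFiniteMeasure μ] z,
        Integrable (fun x => Complex.exp ((inner ℝ x z : ℝ) * Complex.I)) μ := fun μ _ z =>
      (integrable_const (1 : ℝ)).mono (by fun_prop) (by simp)
    have hchar : ∀ (μ : Measure (EuclideanSpace ℝ (Fin d))) [IsFiniteMeasure μ] (c : ℝ) z,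
        charFun (μ + ENNReal.ofReal c • Measure.dirac 0) z = charFun μ z + (max c 0 : ℝ) :=
      fun μ _ c z => by
        rw [charFun_apply, integral_add_measure (hint _ z) ((hint _ z).smul_measure (by simp)),
          integral_smul_measure, ← charFun_apply, ← charFun_apply, charFun_dirac,
          ENNReal.toReal_ofReal']
        simp
    have hfinc : ∀ (μ : Measure (EuclideanSpace ℝ (Fin d))) [IsFiniteMeasure μ] (c : ℝ),
        IsFiniteMeasure (μ + ENNReal.ofReal c • Measure.dirac 0) := fun μ _ c => by
      have : IsFiniteMeasure (ENNReal.ofReal c •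
          (Measure.dirac 0 : Measure (EuclideanSpace ℝ (Fin d)))) :=
        Measure.smul_finite _ ENNReal.ofReal_ne_top
      infer_instance
    have := hfinc P (q w)
    have := hfinc N (-q w)
    -- The sign of `q w` is unknown, so its positive part is placed on the left and its negative
    -- part on the right: both sides are then genuine finite measures.
    have hPN : P + ENNReal.ofReal (q w) • Measure.dirac 0
        = N + ENNReal.ofReal (-q w) • Measure.dirac 0 := by
      refine Measure.ext_of_charFun (funext fun z => ?_)
      rw [hchar, hchar, charFun_withDensity hf hf0, charFun_withDensity hf hf0, ← h w z]
      have hmax := congrArg Complex.ofReal (max_zero_sub_max_neg_zero_eq_self (q w))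
      rw [Complex.ofReal_sub] at hmax
      rw [← hmax]
      ring
    have hP0 : P {0} = 0 := withDensity_absolutelyContinuous _ _ hp0
    have hN0 : N {0} = 0 := withDensity_absolutelyContinuous _ _ hn0
    have h0 := congrArg (fun μ : Measure (EuclideanSpace ℝ (Fin d)) => μ {0}) hPN
    simp only [Measure.add_apply, Measure.smul_apply, hP0, hN0, smul_eq_mul, zero_add,
      Measure.dirac_apply_of_mem (Set.mem_singleton _), mul_one] at h0
    have hq : q w = 0 := by
      rcases le_total 0 (q w) with hq | hq
      · rw [ENNReal.ofReal_of_nonpos (neg_nonpos.2 hq), ENNReal.ofReal_eq_zero] at h0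
        exact le_antisymm h0 hq
      · rw [ENNReal.ofReal_of_nonpos hq, eq_comm, ENNReal.ofReal_eq_zero] at h0
        linarith
    refine ⟨hq, ?_⟩
    simpa only [hq, neg_zero, ENNReal.ofReal_zero, zero_smul, add_zero] using hPN
  exact ⟨fun w => (main w).1, eq_of_forall_withDensity_cos_eq hp0 hn0 fun w => (main w).2⟩

/-- Polarization on `e_i + e_j`; symmetry is essential, as a quadratic form does not see an
antisymmetric part. -/
theorem Matrix.IsSymm.eq_zero_of_quadratic {B : Matrix (Fin d) (Fin d) ℝ} (hB : B.IsSymm)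
    (h : ∀ w : EuclideanSpace ℝ (Fin d), ∑ i, ∑ j, w i * B i j * w j = 0) : B = 0 := by
  have hq : ∀ u : Fin d → ℝ, u ⬝ᵥ B.mulVec u = 0 := fun u => by
    rw [← h (WithLp.toLp 2 u)]
    simp [dotProduct, Matrix.mulVec, Finset.mul_sum, mul_assoc]
  ext i j
  have h1 := hq (Pi.single i 1 + Pi.single j 1)
  have h2 := hq (Pi.single i 1)
  have h3 := hq (Pi.single j 1)
  have h4 := hB.apply i j
  simp [Matrix.mulVec_add, add_dotProduct, dotProduct_add] at h1 h2 h3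
  simp
  linarith

/-- Uniqueness of the Lévy-Khintchine representation. -/
theorem levyKhintchine_unique {p n : Measure (EuclideanSpace ℝ (Fin d))}
    (hp : Integrable (fun x => min 1 (‖x‖ ^ 2)) p) (hn : Integrable (fun x => min 1 (‖x‖ ^ 2)) n)
    (hp0 : p {0} = 0) (hn0 : n {0} = 0) {B : Matrix (Fin d) (Fin d) ℝ} (hB : B.IsSymm)
    {g : Fin d → ℝ}
    (h : ∀ z : EuclideanSpace ℝ (Fin d), Complex.I * ((∑ i, g i * z i : ℝ) : ℂ)
      - 1 / 2 * ((∑ i, ∑ j, z i * B i j * z j : ℝ) : ℂ)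
      + ((∫ x, levyKernel z x ∂p) - ∫ x, levyKernel z x ∂n) = 0) :
    B = 0 ∧ g = 0 ∧ p = n := by
  have hsd : ∀ {m : Measure (EuclideanSpace ℝ (Fin d))},
      Integrable (fun x => min 1 (‖x‖ ^ 2)) m → ∀ w z : EuclideanSpace ℝ (Fin d),
      ∫ x, Complex.exp (Complex.I * (inner ℝ z x : ℝ)) *
          ((2 * (1 - Real.cos (inner ℝ w x)) : ℝ) : ℂ) ∂m =
        2 * (∫ x, levyKernel z x ∂m) - (∫ x, levyKernel (z + w) x ∂m)
          - ∫ x, levyKernel (z - w) x ∂m := fun hm w z => by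
    have h1 := (integrable_levyKernel hm z).const_mul 2
    have h2 := integrable_levyKernel hm (z + w)
    have h12 : Integrable (fun x => 2 * levyKernel z x - levyKernel (z + w) x) _ := h1.sub h2
    rw [← integral_const_mul, ← integral_sub h1 h2,
      ← integral_sub h12 (integrable_levyKernel hm _)]
    refine integral_congr_ae (.of_forall fun x => ?_)
    have := levyKernel_second_difference z w x
    simp only
    rw [show (2 * (1 - Real.cos (inner ℝ w x)) : ℝ) = -(2 * (Real.cos (inner ℝ w x) - 1)) by ring,
      Complex.ofReal_neg, mul_neg, ← this]
    ring
  have hlin : ∀ w z : EuclideanSpace ℝ (Fin d),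
      ∑ i, g i * (z + w) i + ∑ i, g i * (z - w) i - 2 * ∑ i, g i * z i = 0 := fun w z => by
    rw [Finset.mul_sum, ← Finset.sum_add_distrib, ← Finset.sum_sub_distrib]
    refine Finset.sum_eq_zero fun i _ => ?_
    simp
    ring
  have hquad : ∀ w z : EuclideanSpace ℝ (Fin d),
      ∑ i, ∑ j, (z + w) i * B i j * (z + w) j + ∑ i, ∑ j, (z - w) i * B i j * (z - w) j
        - 2 * ∑ i, ∑ j, z i * B i j * z j = 2 * ∑ i, ∑ j, w i * B i j * w j := fun w z => by
    simp_rw [Finset.mul_sum, ← Finset.sum_add_distrib, ← Finset.sum_sub_distrib]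
    refine Finset.sum_congr rfl fun i _ => Finset.sum_congr rfl fun j _ => ?_
    simp
    ring
  -- Second difference of `h` at `z` in direction `w`. The factor `2` in `hquad` cancels the `1/2`
  -- of the Gaussian term, so `q` is the quadratic form itself.
  obtain ⟨h1, h2⟩ := eq_of_charFun_withDensity_cos hp hn hp0 hn0
    (q := fun w => ∑ i, ∑ j, w i * B i j * w j) fun w z => by
      rw [hsd hp, hsd hn]
      have a := h (z + w)
      have b := h (z - w)
      have c := h z
      have e := congrArg (fun r : ℝ => (r : ℂ)) (hlin w z)
      have f := congrArg (fun r : ℝ => (r : ℂ)) (hquad w z)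
      simp only [Complex.ofReal_add, Complex.ofReal_sub, Complex.ofReal_mul, Complex.ofReal_zero,
        Complex.ofReal_ofNat] at e f
      linear_combination 2 * c - a - b + Complex.I * e - 1 / 2 * f
  have hB0 := hB.eq_zero_of_quadratic h1
  refine ⟨hB0, ?_, h2⟩
  funext i
  -- Only the drift survives in `h`; basis vectors read off its coordinates.
  have := h (EuclideanSpace.single i 1)
  simpa [hB0, h2, Pi.single_apply] using this

end Uniqueness

/-! ### From a trivial exponential to a trivial exponent, and exponents of real triplets -/

/-- The values of `G` lie in the discrete set `2πiℤ`, so continuity on a connected space makes `G`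
constant. -/
theorem eq_zero_of_forall_exp_eq_one {X : Type*} [TopologicalSpace X] [PreconnectedSpace X]
    {G : X → ℂ} (hG : Continuous G) (h : ∀ x, Complex.exp (G x) = 1) {x₀ : X} (h0 : G x₀ = 0)
    (x : X) : G x = 0 := by
  choose n hn using fun x => Complex.exp_eq_one_iff.1 (h x)
  have him : ∀ x, ((n x : ℤ) : ℝ) = (G x).im / (2 * Real.pi) := fun x => by
    rw [hn x]
    simp
  have hc : Continuous n := by
    -- The integers carry the topology induced from `ℝ`, so continuity may be tested on the
    -- real-valued function `Im G / 2π`.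
    refine Int.isClosedEmbedding_coe_real.isInducing.continuous_iff.2 ?_
    have : (Int.cast ∘ n : X → ℝ) = fun x => (G x).im / (2 * Real.pi) := funext him
    rw [this]
    fun_prop
  have h1 : n x = n x₀ := PreconnectedSpace.constant inferInstance hc
  rw [hn x, h1, ← hn x₀, h0]

namespace IsQuasiLevyType

variable {d : ℕ} {ν : borelOffZero d → ℝ}

theorem integrable_posPart (h : IsQuasiLevyType ν) :
    MeasureTheory.Integrable (fun x => min 1 (‖x‖ ^ 2)) h.signed.posPart := by
  simpa using h.integrable.1.re

theorem integrable_negPart (h : IsQuasiLevyType ν) :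
    MeasureTheory.Integrable (fun x => min 1 (‖x‖ ^ 2)) h.signed.negPart := by
  simpa using h.integrable.2.re

theorem eq_zero_of_posPart_eq_negPart (h : IsQuasiLevyType ν)
    (he : h.signed.posPart = h.signed.negPart) (B : borelOffZero d) : ν B = 0 := by
  obtain ⟨B, hB⟩ := B
  obtain ⟨r, hr, hBr⟩ := Set.mem_iUnion₂.1 hB
  rw [← h.signed.restrict_apply hr hBr,
    SignedMeasure.apply_eq_posPart_real_sub_negPart_real _ hBr.1, measureReal_def, measureReal_def,
    ← h.signed.posPart_spec.2 r hr B hBr, ← h.signed.negPart_spec.2 r hr B hBr, he, sub_self]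

end IsQuasiLevyType

/-- The exponent in the Lévy-Khintchine formula for a signed Lévy measure `p - n`. -/
def levyExponent {d : ℕ} (g : Fin d → ℝ) (B : Matrix (Fin d) (Fin d) ℝ)
    (p n : Measure (EuclideanSpace ℝ (Fin d))) (z : EuclideanSpace ℝ (Fin d)) : ℂ :=
  Complex.I * ((∑ i, g i * z i : ℝ) : ℂ) - 1 / 2 * ((∑ i, ∑ j, z i * B i j * z j : ℝ) : ℂ)
    + ((∫ x, levyKernel z x ∂p) - ∫ x, levyKernel z x ∂n)

section levyExponent

variable {d : ℕ} {g : Fin d → ℝ} {B : Matrix (Fin d) (Fin d) ℝ}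
  {p n : Measure (EuclideanSpace ℝ (Fin d))}

theorem levyExponent_zero : levyExponent g B p n 0 = 0 := by
  simp [levyExponent, integral_levyKernel_zero]

/-- Hermitian symmetry holds because `g`, `B`, `p` and `n` are real; it is what separates `R` from
`iH` in the main argument. -/
theorem levyExponent_neg (z : EuclideanSpace ℝ (Fin d)) :
    levyExponent g B p n (-z) = (starRingEnd ℂ) (levyExponent g B p n z) := by
  simp only [levyExponent, integral_levyKernel_neg, map_add, map_sub, map_mul, Complex.conj_ofReal,
    Complex.conj_I, map_div₀, map_one, map_ofNat]
  simp

theorem continuous_levyExponent (hp : Integrable (fun x => min 1 (‖x‖ ^ 2)) p)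
    (hn : Integrable (fun x => min 1 (‖x‖ ^ 2)) n) : Continuous (levyExponent g B p n) := by
  have h1 := continuous_integral_levyKernel hp
  have h2 := continuous_integral_levyKernel hn
  unfold levyExponent
  fun_prop

theorem isQuasiDivisibleExponent_levyExponent (hp : Integrable (fun x => min 1 (‖x‖ ^ 2)) p)
    (hn : Integrable (fun x => min 1 (‖x‖ ^ 2)) n) :
    IsQuasiDivisibleExponent (levyExponent g B p n) := by
  have h1 := (IsDivisibleExponent.inner_left (WithLp.toLp 2 g)).isQuasiDivisibleExponent
  have h2 : IsQuasiDivisibleExponent _ :=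
    IsQuasiDivisibleExponent.sum Finset.univ fun i : Fin d =>
      IsQuasiDivisibleExponent.sum Finset.univ fun j : Fin d =>
        IsQuasiDivisibleExponent.mul_inner_mul_inner (-1 / 2 * B i j)
          (EuclideanSpace.single i 1) (EuclideanSpace.single j 1)
  have h3 := (IsDivisibleExponent.integral_levyKernel hp).isQuasiDivisibleExponent
  have h4 := (IsDivisibleExponent.integral_levyKernel hn).isQuasiDivisibleExponent.neg
  have h := ((h1.add h2).add (h3.add h4))
  convert! h using 2 with z
  simp only [levyExponent, sub_eq_add_neg, EuclideanSpace.inner_single_left]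
  congr 2
  · simp [PiLp.inner_apply, mul_comm]
  · push_cast
    simp_rw [← neg_mul, Finset.mul_sum]
    refine Finset.sum_congr rfl fun i _ => Finset.sum_congr rfl fun j _ => ?_
    simp
    ring

end levyExponent

end

/-! ### The theorem -/

theorem theorem2p5 {d : ℕ} (μ : MeasureTheory.Measure (EuclideanSpace ℝ (Fin d)))
    [MeasureTheory.IsProbabilityMeasure μ]
    (A : Matrix (Fin d) (Fin d) ℂ) (hA : A.IsSymm)
    (ν : borelOffZero d → ℂ) (hν : IsComplexQuasiLevyType ν)
    (γ : Fin d → ℂ)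
    (hμ : ∀ z : EuclideanSpace ℝ (Fin d),
      MeasureTheory.charFun μ z =
        Complex.exp (Complex.I * (∑ i, γ i * (z i : ℂ))
          - 1 / 2 * (∑ i, ∑ j, (z i : ℂ) * A i j * (z j : ℂ))
          + hν.integral (levyKernel z))) :
    (∀ i j, (A i j).im = 0) ∧
    (∀ i, (γ i).im = 0) ∧
    (∀ B, (ν B).im = 0) ∧
    (∃ ν₀ : borelOffZero d → ℝ, IsQuasiLevyType ν₀ ∧ ∀ B, ν B = (ν₀ B : ℂ)) ∧
    IsQuasiInfinitelyDivisible μ := by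
  set R := levyExponent (fun i => (γ i).re) (A.map Complex.re) hν.re.signed.posPart
    hν.re.signed.negPart
  set H := levyExponent (fun i => (γ i).im) (A.map Complex.im) hν.im.signed.posPart
    hν.im.signed.negPart
  have hμ' : ∀ z, charFun μ z = Complex.exp (R z + Complex.I * H z) := fun z => by
    rw [hμ z]
    congr 1
    have h1 : ∑ i, γ i * (z i : ℂ) = ((∑ i, (γ i).re * z i : ℝ) : ℂ)
        + Complex.I * ((∑ i, (γ i).im * z i : ℝ) : ℂ) := by
      push_cast
      rw [Finset.mul_sum, ← Finset.sum_add_distrib]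
      refine Finset.sum_congr rfl fun i _ => ?_
      conv_lhs => rw [← Complex.re_add_im (γ i)]
      ring
    have h2 : ∑ i, ∑ j, (z i : ℂ) * A i j * (z j : ℂ) =
        ((∑ i, ∑ j, z i * (A.map Complex.re) i j * z j : ℝ) : ℂ)
        + Complex.I * ((∑ i, ∑ j, z i * (A.map Complex.im) i j * z j : ℝ) : ℂ) := by
      push_cast
      simp_rw [Finset.mul_sum, ← Finset.sum_add_distrib]
      refine Finset.sum_congr rfl fun i _ => Finset.sum_congr rfl fun j _ => ?_
      conv_lhs => rw [← Complex.re_add_im (A i j)]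
      simp only [Matrix.map_apply]
      ring
    rw [h1, h2]
    simp only [R, H, levyExponent, IsComplexQuasiLevyType.integral, IsSignedOffZero.integral]
    ring
  -- Conjugating the value at `-z` fixes `R z` and `H z` but changes `i` into `-i`.
  have hexp : ∀ z, Complex.exp (2 * Complex.I * H z) = 1 := fun z => by
    have h1 : charFun μ z = (starRingEnd ℂ) (charFun μ (-z)) := by
      rw [charFun_neg, Complex.conj_conj]
    rw [hμ', hμ', ← Complex.exp_conj] at h1
    simp only [R, H, map_add, map_mul, levyExponent_neg, Complex.conj_conj, Complex.conj_I] at h1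
    have h2 : 2 * Complex.I * H z = (R z + Complex.I * H z) - (R z + -Complex.I * H z) := by ring
    rw [h2, Complex.exp_sub, h1, div_self (Complex.exp_ne_zero _)]
  have hH0 : ∀ z, H z = 0 := fun z => by
    have hc : Continuous H :=
      continuous_levyExponent hν.im.integrable_posPart hν.im.integrable_negPart
    -- Pointwise, `hexp` only places `H z` in `πℤ`; continuity and `H 0 = 0` select the value `0`.
    have := eq_zero_of_forall_exp_eq_one (G := fun z => 2 * Complex.I * H z) (by fun_prop) hexp
      (x₀ := 0) (by simp only [H, levyExponent_zero, mul_zero]) z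
    simpa using this
  obtain ⟨hA0, hγ0, hν0⟩ := levyKhintchine_unique hν.im.integrable_posPart
    hν.im.integrable_negPart hν.im.signed.posPart_spec.1 hν.im.signed.negPart_spec.1
    (hA.map Complex.im) hH0
  have him := hν.im.eq_zero_of_posPart_eq_negPart hν0
  refine ⟨fun i j => congrFun (congrFun hA0 i) j, fun i => congrFun hγ0 i, him,
    ⟨fun B => (ν B).re, hν.re, fun B => Complex.ext rfl (him B)⟩, ?_⟩
  have hR : IsQuasiDivisibleExponent R :=
    isQuasiDivisibleExponent_levyExponent hν.re.integrable_posPart hν.re.integrable_negPart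
  exact hR.isQuasiInfinitelyDivisible fun z => by rw [hμ', hH0, mul_zero, add_zero]
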